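/- **Definitions.** Let $\mathcal{C}$ be a small category. For an object $c$ of $\mathcal{C}$, an *admissible order* on the morphisms from $c$ is a choice of a well-order $\prec$ on each set $\mathrm{Hom}(c,c')$ such that $f\prec f'$ implies $g\circ f\prec g\circ f'$ for all $f,f':c\to c'$ and all $g:c'\to c''$. The set of all morphisms from $c$ carries the preorder in which $f\le g$ if $g=h\circ f$ for some $h$; let $|c/\mathcal{C}|$ be the poset generated by this preorder. The category $\mathcal{C}$ is *Gröbner* if for every object $c$ (G1) the morphisms from $c$ admit an admissible order, and (G2) $|c/\mathcal{C}|$ is Noetherian, i.e. for every sequence $x_1,x_2,\dots$ in it there are $i<j$ with $x_i\le x_j$. A functor $\Phi:\mathcal{C}\to\mathcal{D}$ has *property (F)* if for every object $d$ of $\mathcal{D}$ there are finitely many objects $c_1,\dots,c_n$ of $\mathcal{C}$ and morphisms $f_i:d\to\Phi(c_i)$ such that every morphism $f:d\to\Phi(c)$, for any object $c$ of $\mathcal{C}$, equals $\Phi(g)\circ f_i$ for some $i$ and some $g:c_i\to c$. A category $\mathcal{D}$ is *quasi-Gröbner* if there is an essentially surjective functor $\Phi:\mathcal{C}\to\mathcal{D}$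 with property (F) from a Gröbner category $\mathcal{C}$. *Connes' cyclic category* $\Lambda$ has objects $[n]$ for $n\ge 0$. A morphism $[m]\to[n]$ is an equivalence class of weakly monotone maps $f:\mathbb{Z}\to\mathbb{Z}$ with $f(i+m+1)=f(i)+n+1$ for all $i$, where $f$ and $f'$ are equivalent if $f'-f$ is a constant multiple of $n+1$; composition is composition of maps. A morphism is a *cyclic injection* if the maps $f:\mathbb{Z}\to\mathbb{Z}$ representing it are injective (equivalently, if the induced map $\mathbb{Z}/(m+1)\to\mathbb{Z}/(n+1)$ is injective). **Proposition.** Connes' cyclic category $\Lambda$ is quasi-Gröbner, and its wide subcategory of cyclic injections is quasi-Gröbner. -/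

import Mathlib

open CategoryTheory

universe v u v₁ u₁ v₂ u₂

section Groebner

/-- An admissible order on the set of morphisms from `c`: a lift of `Hom(c, -)` to the category
of well-orders and strictly order preserving maps. It consists of a (strict) well-order on each
set `Hom(c, d)` such that postcomposition with any morphism is strictly order preserving. -/
structure AdmissibleOrder {C : Type u} [Category.{v} C] (c : C) where
  lt : ∀ d : C, (c ⟶ d) → (c ⟶ d) → Prop
  isWellOrder : ∀ d : C, IsWellOrder (c ⟶ d) (lt d)
  lt_comp : ∀ {d e : C} (f f' : c ⟶ d) (g : d ⟶ e), lt d f f' → lt e (f ≫ g) (f' ≫ g)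

/-- The set of all morphisms from `c`. -/
structure MorphismsFrom {C : Type u} [Category.{v} C] (c : C) where
  target : C
  hom : c ⟶ target

/-- The canonical preorder on the set of morphisms from `c`: `f ≤ g` if `g = h ∘ f` for
some `h`. -/
instance MorphismsFrom.instPreorder {C : Type u} [Category.{v} C] (c : C) :
    Preorder (MorphismsFrom c) where
  le f g := ∃ h : f.target ⟶ g.target, f.hom ≫ h = g.hom
  le_refl f := ⟨𝟙 _, Category.comp_id _⟩
  le_trans f g k := by
    rintro ⟨a, ha⟩ ⟨b, hb⟩
    exact ⟨a ≫ b, by rw [← Category.assoc, ha, hb]⟩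

/-- The poset `|c/C|` generated by the preorder on the morphisms from `c`. -/
abbrev SlicePoset {C : Type u} [Category.{v} C] (c : C) : Type (max u v) :=
  Antisymmetrization (MorphismsFrom c) (· ≤ ·)

/-- A small category is Gröbner if for each object `c` the morphisms from `c` admit an admissible
order (G1), and the poset `|c/C|` is Noetherian (G2), that is, every sequence `x₀, x₁, …` in it
has indices `i < j` with `xᵢ ≤ xⱼ`. -/
structure IsGroebner (C : Type u) [SmallCategory C] : Prop where
  admissible : ∀ c : C, Nonempty (AdmissibleOrder c)
  noetherian : ∀ c : C, WellQuasiOrderedLE (SlicePoset c)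

/-- Property (F) of a functor `Φ`: for each object `d` of the target there are finitely many
morphisms `fᵢ : d ⟶ Φ(cᵢ)` such that each morphism `d ⟶ Φ(c)` is of the form `Φ(g) ∘ fᵢ`. -/
def PropertyF {C : Type u₁} [Category.{v₁} C] {D : Type u₂} [Category.{v₂} D]
    (Φ : C ⥤ D) : Prop :=
  ∀ d : D, ∃ (n : ℕ) (c : Fin n → C) (f : ∀ i, d ⟶ Φ.obj (c i)),
    ∀ (c' : C) (k : d ⟶ Φ.obj c'), ∃ (i : Fin n) (g : c i ⟶ c'), k = f i ≫ Φ.map g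

/-- A category is quasi-Gröbner if it admits an essentially surjective functor with property (F)
from a (small) Gröbner category. -/
def IsQuasiGroebner (D : Type u) [Category.{v} D] : Prop :=
  ∃ (C : Type (max u v)) (_ : SmallCategory C) (Φ : C ⥤ D),
    IsGroebner C ∧ Φ.EssSurj ∧ PropertyF Φ

end Groebner

/-- The objects `[n]`, `n ≥ 0`, of Connes' cyclic category `Λ`; here `[n]` stands for the set
`ℤ/(n+1)` with its cyclic order. -/
structure ConnesCyclic where
  len : ℕ

namespace ConnesCyclic

/-- The weakly monotone maps `f : ℤ → ℤ` with `f (i + (m + 1)) = f i + (n + 1)`. -/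
@[ext]
structure Lift (m n : ConnesCyclic) where
  toFun : ℤ → ℤ
  monotone : Monotone toFun
  map_add : ∀ i : ℤ, toFun (i + (m.len + 1)) = toFun i + (n.len + 1)

/-- Two lifts are equivalent if they differ by a multiple of the period `n + 1` of the target. -/
instance Lift.setoid (m n : ConnesCyclic) : Setoid (Lift m n) where
  r f g := ∃ k : ℤ, ∀ i : ℤ, g.toFun i = f.toFun i + k * (n.len + 1)
  iseqv :=
    { refl := fun _ => ⟨0, fun _ => by ring⟩
      symm := by
        rintro f g ⟨k, hk⟩
        exact ⟨-k, fun i => by rw [hk]; ring⟩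
      trans := by
        rintro f g h ⟨k, hk⟩ ⟨l, hl⟩
        exact ⟨k + l, fun i => by rw [hl, hk]; ring⟩ }

def Lift.id (m : ConnesCyclic) : Lift m m where
  toFun i := i
  monotone := monotone_id
  map_add _ := rfl

/-- `f.comp g` is `g ∘ f`. -/
def Lift.comp {l m n : ConnesCyclic} (f : Lift l m) (g : Lift m n) : Lift l n where
  toFun i := g.toFun (f.toFun i)
  monotone := g.monotone.comp f.monotone
  map_add i := by rw [f.map_add, g.map_add]

theorem Lift.map_add_mul {m n : ConnesCyclic} (f : Lift m n) (k i : ℤ) :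
    f.toFun (i + k * (m.len + 1)) = f.toFun i + k * (n.len + 1) := by
  induction k using Int.induction_on with
  | zero => simp
  | succ k ih =>
    have h := f.map_add (i + k * (m.len + 1))
    rw [ih] at h
    rw [show i + ((k : ℤ) + 1) * ((m.len : ℤ) + 1)
      = i + k * (m.len + 1) + (m.len + 1) by ring, h]
    ring
  | pred k ih =>
    have h := f.map_add (i + (-(k : ℤ) - 1) * (m.len + 1))
    rw [show i + (-(k : ℤ) - 1) * ((m.len : ℤ) + 1) + (m.len + 1)
      = i + -(k : ℤ) * (m.len + 1) by ring, ih] at h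
    linarith

/-- Connes' cyclic category `Λ`: morphisms `[m] ⟶ [n]` are equivalence classes of lifts. -/
instance category : SmallCategory ConnesCyclic where
  Hom m n := Quotient (Lift.setoid m n)
  id m := ⟦Lift.id m⟧
  comp := Quotient.map₂ Lift.comp (by
    rintro f f' ⟨k, hk⟩ g g' ⟨l, hl⟩
    refine ⟨k + l, fun i => ?_⟩
    change g'.toFun (f'.toFun i) = g.toFun (f.toFun i) + _
    rw [hl, hk, g.map_add_mul]
    ring)
  id_comp := by
    rintro _ _ ⟨f⟩
    rfl
  comp_id := by
    rintro _ _ ⟨f⟩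
    rfl
  assoc := by
    rintro _ _ _ _ ⟨f⟩ ⟨g⟩ ⟨h⟩
    rfl

/-- Cyclic injections: the morphisms of `Λ` whose lifts `ℤ → ℤ` are injective (this does not
depend on the choice of the lift). Equivalently, the induced map `ℤ/(m+1) → ℤ/(n+1)` is
injective. -/
def cyclicInjections : MorphismProperty ConnesCyclic := fun m n =>
  Quotient.lift (fun f : Lift m n => Function.Injective f.toFun) (by
    rintro f g ⟨k, hk⟩
    refine propext ⟨fun h i j hij => h ?_, fun h i j hij => h ?_⟩
    · rw [hk, hk] at hij
      exact add_right_cancel hij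
    · rw [hk, hk, hij])

instance : cyclicInjections.IsMultiplicative where
  id_mem _ := fun _ _ h => h
  comp_mem := by
    rintro _ _ _ ⟨f⟩ ⟨g⟩ hf hg
    exact fun _ _ h => hf (hg h)

end ConnesCyclic

/-! Both claims use one Gröbner category, `BasedCyclic`: strictly monotone lifts fixing `0`. Its hom
sets are finite, so lexicographic comparison of values on a period is a well-order, and it is
preserved by strictly monotone postcomposition. A morphism divides another as soon as its
consecutive gaps are pointwise smaller (`BasedCyclic.le_of_gaps_le`), so (G2) reduces to Dickson's
lemma. For property (F), any lift `f` from `[m]` factors through the based injection that enumerates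
the residues hit by `f` together with `0` (`Lift.exists_factorization`). At most `m + 2` residues
occur and hom sets are finite, so finitely many first factors suffice. -/

namespace ConnesCyclic

/-! ### Periodic monotone maps and their right adjoints -/

namespace Lift

variable {m n p : ConnesCyclic}

/-- A lift is determined by its values on the fundamental domain `0, …, m`. -/
theorem ext_of_nat {f g : Lift m n} (h : ∀ i : Fin (m.len + 1), f.toFun i = g.toFun i) :
    f = g := by
  ext x
  have hm : (0 : ℤ) < m.len + 1 := by positivity
  have h0 := Int.emod_nonneg x hm.ne'
  have h1 := Int.emod_lt_of_pos x hm
  have hx : x = x % (m.len + 1) + x / (m.len + 1) * (m.len + 1) := by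
    linarith [Int.emod_add_mul_ediv x (m.len + 1)]
  have key := h ⟨(x % (m.len + 1)).toNat, by omega⟩
  simp only [Int.toNat_of_nonneg h0] at key
  rw [hx, f.map_add_mul, g.map_add_mul, key]

/-- There are finitely many lifts sending `0` to `0, …, n`. -/
instance finite_normalized :
    Finite {f : Lift m n // 0 ≤ f.toFun 0 ∧ f.toFun 0 ≤ n.len} := by
  have hb : ∀ (f : {f : Lift m n // 0 ≤ f.toFun 0 ∧ f.toFun 0 ≤ n.len}) (i : Fin (m.len + 1)),
      f.1.toFun i ∈ Set.Icc (0 : ℤ) (2 * n.len + 1) := by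
    rintro ⟨f, h0, h1⟩ i
    have h2 := f.map_add 0
    have h3 := f.monotone (show (0 : ℤ) ≤ i by positivity)
    have h4 := f.monotone (show (i : ℤ) ≤ 0 + (m.len + 1) by have := i.2; omega)
    exact ⟨by linarith, by linarith⟩
  refine Finite.of_injective
    (fun f (i : Fin (m.len + 1)) => (⟨f.1.toFun i, hb f i⟩ : Set.Icc (0 : ℤ) (2 * n.len + 1))) ?_
  intro f g hfg
  exact Subtype.ext (ext_of_nat fun i => congrArg Subtype.val (congrFun hfg i))

theorem exists_isGreatest (f : Lift m n) (y : ℤ) :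
    ∃ x : ℤ, f.toFun x ≤ y ∧ ∀ z : ℤ, f.toFun z ≤ y → z ≤ x := by
  have hm : (0 : ℤ) < m.len + 1 := by positivity
  have hn : (0 : ℤ) ≤ n.len := by positivity
  have a1 := neg_abs_le y
  have a2 := le_abs_self y
  have a3 := neg_abs_le (f.toFun 0)
  have a4 := le_abs_self (f.toFun 0)
  -- By periodicity `f` moves by `n + 1 ≥ 1` per period, so `|y| + |f 0|` periods, plus one for
  -- strictness above, suffice to pass `y`.
  refine Int.exists_greatest_of_bdd ⟨(|y| + |f.toFun 0| + 1) * (m.len + 1), fun z hz => ?_⟩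
    ⟨0 + (-(|y| + |f.toFun 0|)) * (m.len + 1), ?_⟩
  · by_contra! hlt
    have h := f.monotone hlt.le
    have h' := f.map_add_mul (|y| + |f.toFun 0| + 1) 0
    rw [zero_add] at h'
    rw [h'] at h
    nlinarith [abs_nonneg y, abs_nonneg (f.toFun 0)]
  · rw [f.map_add_mul]
    nlinarith [abs_nonneg y, abs_nonneg (f.toFun 0)]

/-- The right adjoint of a lift. -/
noncomputable def rightAdjoint (f : Lift m n) : Lift n m where
  toFun y := (f.exists_isGreatest y).choose
  monotone y y' h := (f.exists_isGreatest y').choose_spec.2 _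
    ((f.exists_isGreatest y).choose_spec.1.trans h)
  map_add y := by
    obtain ⟨h1, h2⟩ := (f.exists_isGreatest y).choose_spec
    obtain ⟨h3, h4⟩ := (f.exists_isGreatest (y + (n.len + 1))).choose_spec
    refine le_antisymm ?_ (h4 _ (by rw [f.map_add]; linarith))
    have := h2 ((f.exists_isGreatest (y + (n.len + 1))).choose - (m.len + 1)) (by
      have := f.map_add ((f.exists_isGreatest (y + (n.len + 1))).choose - (m.len + 1))
      rw [sub_add_cancel] at this
      linarith)
    linarith

theorem gc_rightAdjoint (f : Lift m n) : GaloisConnection f.toFun f.rightAdjoint.toFun :=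
  fun x y => ⟨(f.exists_isGreatest y).choose_spec.2 x,
    fun h => (f.monotone h).trans (f.exists_isGreatest y).choose_spec.1⟩

theorem rightAdjoint_apply (f : Lift m n) {x : ℤ} (h : f.toFun x < f.toFun (x + 1)) :
    f.rightAdjoint.toFun (f.toFun x) = x := by
  refine le_antisymm ?_ (f.gc_rightAdjoint.le_u_l x)
  by_contra! hlt
  exact absurd ((f.gc_rightAdjoint _ _).2 (Int.add_one_le_of_lt hlt)) (not_le.2 h)

/-- If the gaps of `f` are at most those of `g`, then `g - f` is monotone. -/
theorem monotone_sub {f : Lift m n} {g : Lift m p}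
    (h : ∀ i : Fin (m.len + 1), f.toFun (i + 1) - f.toFun i ≤ g.toFun (i + 1) - g.toFun i) :
    Monotone fun x => g.toFun x - f.toFun x := by
  refine monotone_int_of_le_succ fun x => ?_
  have hm : (0 : ℤ) < m.len + 1 := by positivity
  have h0 := Int.emod_nonneg x hm.ne'
  have h1 := Int.emod_lt_of_pos x hm
  have hx : x = x % (m.len + 1) + x / (m.len + 1) * (m.len + 1) := by
    linarith [Int.emod_add_mul_ediv x (m.len + 1)]
  have key := h ⟨(x % (m.len + 1)).toNat, by omega⟩
  simp only [Int.toNat_of_nonneg h0] at key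
  rw [hx, add_right_comm, f.map_add_mul, g.map_add_mul, f.map_add_mul, g.map_add_mul]
  linarith

/-- Translate each `x` by the displacement `g - f` at the last point that `f` sends to at most `x`.
The result is the identity plus a monotone map, hence strict; on the image of `f` the adjoint undoes
`f`. -/
theorem exists_comp_eq {f : Lift m n} {g : Lift m p} (hf : StrictMono f.toFun)
    (h : Monotone fun x => g.toFun x - f.toFun x) :
    ∃ k : Lift n p, StrictMono k.toFun ∧ f.comp k = g := by
  let k : ℤ → ℤ := fun x =>
    x + (g.toFun (f.rightAdjoint.toFun x) - f.toFun (f.rightAdjoint.toFun x))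
  have hk : StrictMono k := strictMono_id.add_monotone (h.comp f.rightAdjoint.monotone)
  refine ⟨⟨k, hk.monotone, fun x => ?_⟩, hk, ?_⟩
  · simp only [k, map_add]
    ring
  · ext x
    change k (f.toFun x) = _
    simp only [k, f.rightAdjoint_apply (hf (lt_add_one x))]
    ring

end Lift

/-! ### Counting and enumerating residues -/

theorem ediv_succ_add_sub {n s : ℤ} (h0 : 0 ≤ s) (hn : s ≤ n) (x : ℤ) :
    (x + 1 + n - s) / (n + 1) = (x + n - s) / (n + 1) + if x % (n + 1) = s then 1 else 0 := by
  have hp : 0 < n + 1 := by linarith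
  have e0 := Int.emod_nonneg x hp.ne'
  have e1 := Int.emod_lt_of_pos x hp
  have e2 := Int.emod_add_mul_ediv x (n + 1)
  have key : ∀ y q : ℤ, q * (n + 1) ≤ y → y < q * (n + 1) + (n + 1) → y / (n + 1) = q :=
    fun y q h h' => (Int.ediv_eq_iff_of_pos hp).2 ⟨h, h'⟩
  rcases lt_trichotomy (x % (n + 1)) s with h | h | h
  · rw [if_neg h.ne, key (x + 1 + n - s) (x / (n + 1)), key (x + n - s) (x / (n + 1)), add_zero]
      <;> linarith
  · rw [if_pos h, key (x + 1 + n - s) (x / (n + 1) + 1), key (x + n - s) (x / (n + 1))]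
      <;> linarith
  · rw [if_neg h.ne', key (x + 1 + n - s) (x / (n + 1) + 1),
      key (x + n - s) (x / (n + 1) + 1), add_zero] <;> linarith

/-- The function counting the elements of `ℤ` that are congruent to elements of
`F ⊆ {0, …, n}`. -/
def countLift (n r : ConnesCyclic) (F : Finset ℤ) (hr : F.card = r.len + 1) : Lift n r where
  toFun x := ∑ s ∈ F, (x + n.len - s) / (n.len + 1)
  monotone x y h := Finset.sum_le_sum fun s _ =>
    Int.ediv_le_ediv (by positivity) (by linarith)
  map_add x := by
    have : ∀ s : ℤ, (x + (n.len + 1) + n.len - s) / (n.len + 1)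
        = (x + n.len - s) / (n.len + 1) + 1 := fun s => by
      have hn : (n.len : ℤ) + 1 ≠ 0 := by positivity
      rw [← Int.add_mul_ediv_right _ _ hn]
      congr 1
      ring
    simp only [this, Finset.sum_add_distrib, Finset.sum_const, hr, nsmul_eq_mul]
    push_cast
    ring

section countLift

variable {n r : ConnesCyclic} {F : Finset ℤ} (hr : F.card = r.len + 1)
  (hF : ∀ s ∈ F, 0 ≤ s ∧ s ≤ n.len)
include hF

theorem countLift_succ (x : ℤ) : (countLift n r F hr).toFun (x + 1)
    = (countLift n r F hr).toFun x + if x % (n.len + 1) ∈ F then 1 else 0 := by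
  change ∑ s ∈ F, _ = ∑ s ∈ F, _ + _
  rw [Finset.sum_congr rfl fun s hs => ediv_succ_add_sub (hF s hs).1 (hF s hs).2 x,
    Finset.sum_add_distrib, Finset.sum_ite_eq]

theorem countLift_zero : (countLift n r F hr).toFun 0 = 0 :=
  Finset.sum_eq_zero fun s hs => by
    have := hF s hs
    exact Int.ediv_eq_zero_of_lt (by linarith) (by linarith)

/-- The adjoint of counting enumerates the integers with residue in `F`. It is strict because one
step to the right raises the count by at most one. -/
theorem strictMono_rightAdjoint_countLift :
    StrictMono (countLift n r F hr).rightAdjoint.toFun := by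
  refine strictMono_int_of_lt_succ fun i => Int.lt_of_add_one_le ?_
  have gc := (countLift n r F hr).gc_rightAdjoint
  refine (gc _ _).1 ?_
  rw [countLift_succ hr hF]
  have := gc.l_u_le i
  split_ifs <;> linarith

theorem rightAdjoint_countLift {x : ℤ} (hx : x % (n.len + 1) ∈ F) :
    (countLift n r F hr).rightAdjoint.toFun ((countLift n r F hr).toFun x) = x :=
  Lift.rightAdjoint_apply _ (by rw [countLift_succ hr hF, if_pos hx]; exact lt_add_one _)

end countLift

/-- Each lift factors as a lift followed by a based injective lift, with a bound on the length of
the intermediate object. -/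
theorem Lift.exists_factorization {m n : ConnesCyclic} (f : Lift m n) :
    ∃ (r : ConnesCyclic) (q : Lift m r) (g : Lift r n), r.len ≤ m.len + 1 ∧
      StrictMono g.toFun ∧ g.toFun 0 = 0 ∧ q.comp g = f := by
  have hm : (0 : ℤ) < m.len + 1 := by positivity
  have hn : (0 : ℤ) < n.len + 1 := by positivity
  let F : Finset ℤ := insert 0 (Finset.univ.image
    fun i : Fin (m.len + 1) => f.toFun i % (n.len + 1))
  have hF : ∀ s ∈ F, 0 ≤ s ∧ s ≤ n.len := by
    intro s hs
    rcases Finset.mem_insert.1 hs with rfl | hs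
    · exact ⟨le_rfl, by positivity⟩
    · obtain ⟨i, -, rfl⟩ := Finset.mem_image.1 hs
      exact ⟨Int.emod_nonneg _ hn.ne', Int.lt_add_one_iff.1 (Int.emod_lt_of_pos _ hn)⟩
  -- The `m + 1` values on a period, and `0`, which makes the second factor based.
  have hcard : F.card ≤ m.len + 2 :=
    (Finset.card_insert_le _ _).trans (Nat.succ_le_succ (Finset.card_image_le.trans (by simp)))
  have hpos : 0 < F.card := Finset.card_pos.2 ⟨0, Finset.mem_insert_self _ _⟩
  have hfF : ∀ x, f.toFun x % (n.len + 1) ∈ F := by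
    intro x
    have h0 := Int.emod_nonneg x hm.ne'
    have h1 := Int.emod_lt_of_pos x hm
    have hx : x = x % (m.len + 1) + x / (m.len + 1) * (m.len + 1) := by
      linarith [Int.emod_add_mul_ediv x (m.len + 1)]
    refine Finset.mem_insert_of_mem (Finset.mem_image.2
      ⟨⟨(x % (m.len + 1)).toNat, by omega⟩, Finset.mem_univ _, ?_⟩)
    simp only [Int.toNat_of_nonneg h0]
    conv_rhs => rw [hx, f.map_add_mul, Int.add_mul_emod_self_right]
  let r : ConnesCyclic := ⟨F.card - 1⟩
  have hr : F.card = r.len + 1 := (Nat.sub_add_cancel hpos).symm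
  refine ⟨r, f.comp (countLift n r F hr), (countLift n r F hr).rightAdjoint,
    by change F.card - 1 ≤ _; omega, strictMono_rightAdjoint_countLift hr hF, ?_, ?_⟩
  · have := rightAdjoint_countLift hr hF (x := 0) (by simp [F])
    rwa [countLift_zero hr hF] at this
  · ext x
    exact rightAdjoint_countLift hr hF (hfF x)

instance finite_hom (m n : ConnesCyclic) : Finite (m ⟶ n) := by
  refine Finite.of_surjective
    (fun f : {f : Lift m n // 0 ≤ f.toFun 0 ∧ f.toFun 0 ≤ n.len} => (⟦f.1⟧ : m ⟶ n)) ?_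
  rintro ⟨f⟩
  have hn : (0 : ℤ) < n.len + 1 := by positivity
  have h0 := Int.emod_nonneg (f.toFun 0) hn.ne'
  have h1 := Int.emod_lt_of_pos (f.toFun 0) hn
  have e := Int.emod_add_mul_ediv (f.toFun 0) (n.len + 1)
  refine ⟨⟨⟨fun x => f.toFun x - f.toFun 0 / (n.len + 1) * (n.len + 1),
    fun x y h => sub_le_sub_right (f.monotone h) _, fun x => ?_⟩, ?_, ?_⟩, ?_⟩
  · rw [f.map_add]
    ring
  · linarith
  · linarith
  · exact Quotient.sound ⟨f.toFun 0 / (n.len + 1), fun x => by ring⟩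

end ConnesCyclic

/-! ### The Gröbner category of based injections -/

/-- The category of based cyclic injections, represented by strictly monotone lifts that map `0`
to `0`. -/
structure BasedCyclic where
  toCyclic : ConnesCyclic

namespace BasedCyclic

open ConnesCyclic

instance category : SmallCategory BasedCyclic where
  Hom m n := {f : Lift m.toCyclic n.toCyclic // StrictMono f.toFun ∧ f.toFun 0 = 0}
  id m := ⟨Lift.id _, strictMono_id, rfl⟩
  comp f g := ⟨f.1.comp g.1, g.2.1.comp f.2.1, by
    change g.1.toFun (f.1.toFun 0) = 0
    rw [f.2.2, g.2.2]⟩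

variable {m n p : BasedCyclic}

instance finite_hom : Finite (m ⟶ n) :=
  Finite.of_injective
    (fun f : m ⟶ n => (⟨f.1, f.2.2.ge, by rw [f.2.2]; positivity⟩ :
      {f : Lift m.toCyclic n.toCyclic // 0 ≤ f.toFun 0 ∧ f.toFun 0 ≤ n.toCyclic.len}))
    fun _ _ h => Subtype.ext (by simpa using h)

/-- The values of a morphism, in lexicographic order. -/
def values (f : m ⟶ n) : Lex (Fin (m.toCyclic.len + 1) → ℤ) :=
  toLex fun i => f.1.toFun i

theorem values_injective : Function.Injective (values : (m ⟶ n) → _) :=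
  fun _ _ h => Subtype.ext (Lift.ext_of_nat (congrFun (toLex.injective h)))

/-- The lexicographic order is admissible. -/
noncomputable def admissibleOrder (m : BasedCyclic) : AdmissibleOrder m where
  lt n f f' := values f < values f'
  isWellOrder n :=
    -- A linear order on a finite set is a well-order.
    letI : LinearOrder (m ⟶ n) := LinearOrder.lift' values values_injective
    inferInstanceAs (IsWellOrder (m ⟶ n) (· < ·))
  lt_comp := by
    rintro n p f f' g ⟨i, hi, hlt⟩
    exact ⟨i, fun j hj => congrArg g.1.toFun (hi j hj), g.2.1 hlt⟩

/-- The gaps between the consecutive values of a morphism. -/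
def gaps {m : BasedCyclic} (f : MorphismsFrom m) (i : Fin (m.toCyclic.len + 1)) : ℕ :=
  (f.hom.1.toFun (i + 1) - f.hom.1.toFun i).toNat

theorem le_of_gaps_le {f g : MorphismsFrom m} (h : gaps f ≤ gaps g) : f ≤ g := by
  obtain ⟨k, hk, hfg⟩ := Lift.exists_comp_eq f.hom.2.1 (g := g.hom.1)
    (Lift.monotone_sub fun i => by
      have h1 : (f.hom.1.toFun (i + 1) - f.hom.1.toFun i).toNat
        ≤ (g.hom.1.toFun (i + 1) - g.hom.1.toFun i).toNat := h i
      have h2 := f.hom.2.1 (lt_add_one (i : ℤ))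
      have h3 := g.hom.2.1 (lt_add_one (i : ℤ))
      omega)
  refine ⟨⟨k, hk, ?_⟩, Subtype.ext hfg⟩
  have := congrArg (fun l => Lift.toFun l 0) hfg
  change k.toFun (f.hom.1.toFun 0) = g.hom.1.toFun 0 at this
  rwa [f.hom.2.2, g.hom.2.2] at this

theorem isGroebner : IsGroebner BasedCyclic where
  admissible m := ⟨admissibleOrder m⟩
  noetherian m :=
    have : WellQuasiOrderedLE (MorphismsFrom m) := ⟨fun f => by
      -- Dickson's lemma for tuples of natural numbers.
      obtain ⟨i, j, hij, h⟩ := wellQuasiOrdered_le fun k => gaps (f k)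
      exact ⟨i, j, hij, le_of_gaps_le h⟩⟩
    toAntisymmetrization_mono.wellQuasiOrderedLE_of_wellQuasiOrderedLE_of_surjective
      Quotient.mk_surjective

/-- The functor to the category of cyclic injections. -/
def toInjections : BasedCyclic ⥤ WideSubcategory cyclicInjections where
  obj m := ⟨m.toCyclic⟩
  map f := ⟨⟦f.1⟧, f.2.1.injective⟩

/-- The functor to Connes' cyclic category. -/
def toConnes : BasedCyclic ⥤ ConnesCyclic where
  obj m := m.toCyclic
  map f := ⟦f.1⟧

end BasedCyclic

/-! ### Property (F) -/

/-- A functor from `BasedCyclic` to a category with finite hom sets has property (F) if each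
morphism `d ⟶ Φ(c)` factors through `Φ(r)` with a bound on `r` that depends only on `d`. -/
theorem propertyF_of_factorization {D : Type u} [Category.{v} D] (Φ : BasedCyclic ⥤ D)
    [∀ d e : D, Finite (d ⟶ e)] (N : D → ℕ)
    (h : ∀ (d : D) (c : BasedCyclic) (k : d ⟶ Φ.obj c),
      ∃ (r : BasedCyclic) (q : d ⟶ Φ.obj r) (g : r ⟶ c), r.toCyclic.len ≤ N d ∧ q ≫ Φ.map g = k) :
    PropertyF Φ := by
  intro d
  obtain ⟨n, ⟨e⟩⟩ := Finite.exists_equiv_fin (Σ r : Fin (N d + 1), d ⟶ Φ.obj ⟨⟨r⟩⟩)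
  refine ⟨n, fun i => ⟨⟨(e.symm i).1⟩⟩, fun i => (e.symm i).2, fun c k => ?_⟩
  obtain ⟨⟨⟨r⟩⟩, q, g, hr, rfl⟩ := h d c k
  obtain ⟨i, hi⟩ := e.symm.surjective ⟨⟨r, Nat.lt_succ_of_le hr⟩, q⟩
  refine ⟨i, ?_⟩
  beta_reduce
  rw [hi]
  exact ⟨g, rfl⟩

namespace BasedCyclic

open ConnesCyclic

theorem propertyF_toConnes : PropertyF toConnes := by
  refine propertyF_of_factorization _ (fun d => d.len + 1) ?_
  rintro d c ⟨f⟩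
  obtain ⟨r, q, g, hr, hg, hg0, rfl⟩ := f.exists_factorization
  exact ⟨⟨r⟩, ⟦q⟧, ⟨g, hg, hg0⟩, hr, rfl⟩

theorem propertyF_toInjections : PropertyF toInjections := by
  have (d e : WideSubcategory cyclicInjections) : Finite (d ⟶ e) :=
    Finite.of_injective (fun f : d ⟶ e => f.hom) fun _ _ => WideSubcategory.hom_ext _
  refine propertyF_of_factorization _ (fun d => d.obj.len + 1) ?_
  rintro d c ⟨⟨f⟩, hf⟩
  obtain ⟨r, q, g, hr, hg, hg0, rfl⟩ := f.exists_factorization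
  -- The first factor of an injective composite is injective, so the factorization stays among
  -- cyclic injections.
  exact ⟨⟨r⟩, ⟨⟦q⟧, Function.Injective.of_comp (f := g.toFun) hf⟩, ⟨g, hg, hg0⟩, hr, rfl⟩

end BasedCyclic

/-- Connes' cyclic category and its (wide) subcategory of cyclic injections are quasi-Gröbner. -/
theorem mainTheorem7 :
    IsQuasiGroebner ConnesCyclic ∧
      IsQuasiGroebner (WideSubcategory ConnesCyclic.cyclicInjections) :=
  ⟨⟨BasedCyclic, inferInstance, BasedCyclic.toConnes, BasedCyclic.isGroebner,
      ⟨fun d => ⟨⟨d⟩, ⟨Iso.refl _⟩⟩⟩, BasedCyclic.propertyF_toConnes⟩,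
    ⟨BasedCyclic, inferInstance, BasedCyclic.toInjections, BasedCyclic.isGroebner,
      ⟨fun d => ⟨⟨d.obj⟩, ⟨Iso.refl _⟩⟩⟩, BasedCyclic.propertyF_toInjections⟩⟩
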